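/- Let $\mathbb K$ be a field, $n\ge 2$, $\mathbf a=(a_1,\dots,a_n)$ with all $a_i\ge 2$ integers, and $\mathbf q=(q_{ij})$ an $n\times n$ matrix over $\mathbb K$ with $q_{ii}=1$ and $q_{ij}q_{ji}=1$ for all $i,j$. Let $$A=A(\mathbf q,\mathbf a)=\mathbb K\langle x_1,\dots,x_n\rangle/\langle x_i^{a_i},\ x_jx_i-q_{ij}x_ix_j \mid 1\le i,j\le n\rangle$$ be the quantum complete intersection. Put $V=\{\mathbf v\in\mathbb N_0^n : v_i\le a_i-1 \text{ for all } i\}$ and $x_{\mathbf v}=x_1^{v_1}\cdots x_n^{v_n}$; the $x_{\mathbf v}$, $\mathbf v\in V$, form a basis of $A$, and $x_{\mathbf v}$ has degree $\sum_i v_i$. Put $\mathbf a-\mathbf 1=(a_1-1,\dots,a_n-1)$ and let $\mathbf e_i$ be the $i$-th unit vector. For $\mathbf u,\mathbf v\in\mathbb Z^n$ put $\mathbf q^{\langle \mathbf u|\mathbf v\rangle}=\prod_{i<j}q_{ij}^{u_jv_i}$ and $h_{\mathbf v}=\mathbf q^{\langle \mathbf a-\mathbf 1-\mathbf v|\mathbf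 v\rangle}/\mathbf q^{\langle \mathbf v|\mathbf a-\mathbf 1-\mathbf v\rangle}$. A permutation $\sigma\in S_n$ acts on vectors by $\sigma(\mathbf v)=(v_{\sigma^{-1}(1)},\dots,v_{\sigma^{-1}(n)})$; put $q_\sigma=\prod_{1\le j<k\le n}\bigl(\mathbf q^{\langle\sigma(\mathbf e_k)|\sigma(\mathbf e_j)\rangle}\bigr)^{(a_k-1)(a_j-1)}$, and call $\sigma$ compatible if $a_{\sigma(i)}=a_i$ and $q_{\sigma(i)\sigma(j)}=q_{ji}$ for all $i,j$. The canonical Nakayama automorphism of $A$ is the unique algebra automorphism $\mathcal N$ with $\phi_0(xy)=\phi_0(y\,\mathcal N(x))$ for all $x,y\in A$, where $\phi_0=x_{\mathbf a-\mathbf 1}^*$ is the element of the dual basis belonging to $x_{\mathbf a-\mathbf 1}$; $\phi_0$ is a Frobenius homomorphism of $A$, that is, $A^*=\{x\mapsto\phi_0(xb) : b\in A\}$. A bi-Frobenius algebra structure on $A$ consists of a coalgebra structure $(\Delta,\varepsilon)$ on $A$ (with $\Delta(x)=\sum x_1\otimes x_2$), $\phi\in A^*$, $t\in A$, and the linear map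 $S:A\to A$, $S(x)=\sum\phi(t_1x)t_2$ (the antipode), such that: $\varepsilon$ is an algebra homomorphism and $\Delta(1)=1\otimes 1$; $A^*=\{x\mapsto\phi(xb): b\in A\}$ and $A=\{\sum f(t_1)t_2 : f\in A^*\}$; $S(1)=1$, $S(xy)=S(y)S(x)$, $\varepsilon\circ S=\varepsilon$ and $\Delta(S(x))=\sum S(x_2)\otimes S(x_1)$ for all $x,y\in A$. Its antipode is a permutation antipode $(S,\pi)$ if $\pi$ is a permutation of the set $V$ and there are $c_{\mathbf v}\in\mathbb K$ with $S(x_{\mathbf v})=c_{\mathbf v}x_{\pi(\mathbf v)}$ for all $\mathbf v\in V$. **Theorem.** Suppose $A=A(\mathbf q,\mathbf a)$ has a bi-Frobenius algebra structure with permutation antipode $(S,\pi)$. Then: (i) $S(x_{\mathbf a-\mathbf 1})=x_{\mathbf a-\mathbf 1}$; $\pi(\mathbf a-\mathbf 1)=\mathbf a-\mathbf 1$; $\pi^2=\mathrm{Id}$; $S$ is a graded map (it maps each homogeneous component of $A$ into itself); $S^2=\mathcal N$; and $S^4=\mathrm{Id}$. (ii) There is a compatible permutation $\sigma\in S_n$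 that induces $\pi$, that is, for all $\mathbf v\in V$, $$\pi(\mathbf v)=(v_{\sigma^{-1}(1)},\dots,v_{\sigma^{-1}(n)}),\qquad x_{\pi(\mathbf v)}=x_1^{v_{\sigma^{-1}(1)}}\cdots x_n^{v_{\sigma^{-1}(n)}},$$ and there are $c_1,\dots,c_n\in\mathbb K$ with $S(x_i)=c_ix_{\sigma(i)}$ and $c_ic_{\sigma(i)}=h_{\mathbf e_i}$ for all $1\le i\le n$, and $$q_\sigma\prod_{1\le i\le n}c_i^{a_i-1}=1.$$ -/

import Mathlib

open scoped TensorProduct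

/-! ### Frobenius algebras, Frobenius coalgebras and bi-Frobenius algebras -/

section BiFrobenius

variable {K A : Type*} [Field K] [Ring A] [Algebra K A]

/-- The pair `(A, φ)` is a Frobenius algebra (for `A` finite-dimensional): `A^* = A ⇀ φ`, where
`(b ⇀ φ)(x) = φ (x b)`. -/
def IsFrobeniusForm (φ : A →ₗ[K] K) : Prop :=
  ∀ f : A →ₗ[K] K, ∃ b : A, ∀ x : A, f x = φ (x * b)

/-- `N` is the Nakayama automorphism with respect to `φ`: `φ (x y) = φ (y N(x))`.
If `φ` is a Frobenius homomorphism, there is exactly one such `N`. -/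
def IsNakayamaAutomorphism (φ : A →ₗ[K] K) (N : A ≃ₐ[K] A) : Prop :=
  ∀ x y : A, φ (x * y) = φ (y * N x)

/-- The right action `t ↼ f = ∑ f(t₁) t₂` of `f ∈ C^*` on an element `t` of a coalgebra `C`. -/
noncomputable def coalgRightAct {K C : Type*} [Field K] [AddCommGroup C] [Module K C]
    [Coalgebra K C] (t : C) (f : C →ₗ[K] K) : C :=
  TensorProduct.lid K C (f.rTensor C (CoalgebraStruct.comul (R := K) t))

/-- The pair `(C, t)` is a Frobenius coalgebra (for `C` finite-dimensional): `C = t ↼ C^*`. -/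
def IsFrobeniusCoalgElem (K : Type*) {C : Type*} [Field K] [AddCommGroup C] [Module K C]
    [Coalgebra K C] (t : C) : Prop :=
  ∀ c : C, ∃ f : C →ₗ[K] K, c = coalgRightAct t f

/-- The quadruple `(A, φ, t, S)` is a bi-Frobenius algebra, for a finite-dimensional `A` that is
both an algebra and a coalgebra (no compatibility of the two structures is presupposed). -/
structure IsBiFrobenius [Coalgebra K A] (φ : A →ₗ[K] K) (t : A) (S : A →ₗ[K] A) : Prop where
  /-- `S(x) = ∑ φ(t₁ x) t₂`. -/
  antipode_eq : ∀ x : A, S x = coalgRightAct t (φ ∘ₗ LinearMap.mulRight K x)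
  /-- The counit is an algebra homomorphism. -/
  counit_one : CoalgebraStruct.counit (R := K) (1 : A) = 1
  counit_mul : ∀ x y : A, CoalgebraStruct.counit (R := K) (x * y) =
    CoalgebraStruct.counit (R := K) x * CoalgebraStruct.counit (R := K) y
  /-- The identity is group-like. -/
  comul_one : CoalgebraStruct.comul (R := K) (1 : A) = (1 : A) ⊗ₜ[K] (1 : A)
  frobenius_algebra : IsFrobeniusForm φ
  frobenius_coalgebra : IsFrobeniusCoalgElem K t
  /-- `S` is an algebra anti-homomorphism. -/
  antipode_one : S 1 = 1
  antipode_mul : ∀ x y : A, S (x * y) = S y * S x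
  /-- `S` is a coalgebra anti-homomorphism. -/
  counit_antipode : ∀ x : A,
    CoalgebraStruct.counit (R := K) (S x) = CoalgebraStruct.counit (R := K) x
  /-- `Δ(S(x)) = ∑ S(x₂) ⊗ S(x₁)`. -/
  comul_antipode : ∀ x : A, CoalgebraStruct.comul (R := K) (S x) =
    TensorProduct.comm K A A (TensorProduct.map S S (CoalgebraStruct.comul (R := K) x))

end BiFrobenius

/-! ### Quantum complete intersections -/

section QuantumCI

variable {K : Type*} [Field K] {n : ℕ}

/-- The defining relations `x_i ^ a_i = 0` and `x_j x_i = q_{ij} x_i x_j`. -/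
inductive QuantumCIRel (q : Fin n → Fin n → K) (a : Fin n → ℕ) :
    FreeAlgebra K (Fin n) → FreeAlgebra K (Fin n) → Prop
  | pow (i : Fin n) : QuantumCIRel q a (FreeAlgebra.ι K i ^ a i) 0
  | comm (i j : Fin n) : QuantumCIRel q a (FreeAlgebra.ι K j * FreeAlgebra.ι K i)
      (q i j • (FreeAlgebra.ι K i * FreeAlgebra.ι K j))

/-- The quantum complete intersection
`A(q, a) = K⟨x_1, …, x_n⟩ / ⟨x_i ^ a_i, x_j x_i - q_{ij} x_i x_j⟩`. -/
def QuantumCI (q : Fin n → Fin n → K) (a : Fin n → ℕ) : Type _ := RingQuot (QuantumCIRel q a)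

noncomputable instance (q : Fin n → Fin n → K) (a : Fin n → ℕ) : Ring (QuantumCI q a) :=
  inferInstanceAs (Ring (RingQuot (QuantumCIRel q a)))

noncomputable instance (q : Fin n → Fin n → K) (a : Fin n → ℕ) : Algebra K (QuantumCI q a) :=
  inferInstanceAs (Algebra K (RingQuot (QuantumCIRel q a)))

/-- The quotient map from the free algebra. -/
noncomputable def QuantumCI.mk (q : Fin n → Fin n → K) (a : Fin n → ℕ) :
    FreeAlgebra K (Fin n) →ₐ[K] QuantumCI q a :=
  RingQuot.mkAlgHom K (QuantumCIRel q a)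

/-- The generator `x_i`. -/
noncomputable def QuantumCI.gen (q : Fin n → Fin n → K) (a : Fin n → ℕ) (i : Fin n) :
    QuantumCI q a :=
  QuantumCI.mk q a (FreeAlgebra.ι K i)

/-- The ordered monomial `x_v = x_1 ^ v_1 ⋯ x_n ^ v_n`, for `v ∈ ℕ^n`. -/
noncomputable def QuantumCI.mon (q : Fin n → Fin n → K) (a : Fin n → ℕ) (v : Fin n → ℕ) :
    QuantumCI q a :=
  (List.ofFn fun i => QuantumCI.gen q a i ^ v i).prod

/-- The set `V = {v ∈ ℕ^n | v_i ≤ a_i - 1}`; the `x_v` with `v ∈ V` are the standard basis. -/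
abbrev ExpSet (a : Fin n → ℕ) : Type := {v : Fin n → ℕ // ∀ i, v i ≤ a i - 1}

/-- The vector `a - 1 ∈ V`. -/
def ExpSet.top (a : Fin n → ℕ) : ExpSet a := ⟨fun i => a i - 1, fun _ => le_rfl⟩

/-- The component of degree `d`, spanned by the `x_v` with `v ∈ V` and `v_1 + ⋯ + v_n = d`. -/
noncomputable def QuantumCI.degComponent (q : Fin n → Fin n → K) (a : Fin n → ℕ) (d : ℕ) :
    Submodule K (QuantumCI q a) :=
  Submodule.span K {x | ∃ v : ExpSet a, ∑ i, v.1 i = d ∧ x = QuantumCI.mon q a v.1}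

/-- A linear endomorphism is graded if it maps each component of degree `d` into itself. -/
def QuantumCI.IsGraded {q : Fin n → Fin n → K} {a : Fin n → ℕ}
    (S : QuantumCI q a →ₗ[K] QuantumCI q a) : Prop :=
  ∀ d : ℕ, ∀ x ∈ QuantumCI.degComponent q a d, S x ∈ QuantumCI.degComponent q a d

open Classical in
/-- `φ = x_{a-1}^*`, the element of the dual of the standard basis that belongs to `x_{a-1}`. -/
def QuantumCI.IsTopDual {q : Fin n → Fin n → K} {a : Fin n → ℕ} (φ : QuantumCI q a →ₗ[K] K) :
    Prop :=
  ∀ v : ExpSet a, φ (QuantumCI.mon q a v.1) = if v = ExpSet.top a then 1 else 0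

/-- `N` is the canonical Nakayama automorphism of `A(q, a)`, that is, the Nakayama automorphism
with respect to the Frobenius homomorphism `x_{a-1}^*`. -/
def QuantumCI.IsCanonicalNakayama {q : Fin n → Fin n → K} {a : Fin n → ℕ}
    (N : QuantumCI q a ≃ₐ[K] QuantumCI q a) : Prop :=
  ∃ φ : QuantumCI q a →ₗ[K] K,
    QuantumCI.IsTopDual φ ∧ IsFrobeniusForm φ ∧ IsNakayamaAutomorphism φ N

/-- `S` is given on the standard basis by scalars, up to the permutation `π` of `V`. -/
def QuantumCI.IsPermutationAntipode {q : Fin n → Fin n → K} {a : Fin n → ℕ}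
    (S : QuantumCI q a →ₗ[K] QuantumCI q a) (π : Equiv.Perm (ExpSet a)) : Prop :=
  ∃ c : ExpSet a → K, ∀ v : ExpSet a, S (QuantumCI.mon q a v.1) = c v • QuantumCI.mon q a (π v).1

/-- The structure coefficient `q^{⟨u|v⟩} = ∏_{i < j} q_{ij} ^ (u_j v_i)`, for `u, v ∈ ℤ^n`. -/
def strCoeff (q : Fin n → Fin n → K) (u v : Fin n → ℤ) : K :=
  ∏ j, ∏ i ∈ Finset.univ.filter (fun i => i < j), q i j ^ (u j * v i)

/-- `h_v = q^{⟨a-1-v|v⟩} / q^{⟨v|a-1-v⟩}`, for `v ∈ ℤ^n`. -/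
def hCoeff (q : Fin n → Fin n → K) (a : Fin n → ℕ) (v : Fin n → ℤ) : K :=
  strCoeff q (fun i => (a i : ℤ) - 1 - v i) v / strCoeff q v (fun i => (a i : ℤ) - 1 - v i)

/-- The unit vector `e_i ∈ ℤ^n`. -/
def unitVec (i : Fin n) : Fin n → ℤ := Pi.single i 1

/-- The action of `S_n` on vectors, `σ(v) = (v_{σ⁻¹(1)}, …, v_{σ⁻¹(n)})`. -/
def permVec {R : Type*} (σ : Equiv.Perm (Fin n)) (v : Fin n → R) : Fin n → R :=
  fun i => v (σ⁻¹ i)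

/-- `σ` is compatible with `A(q, a)`. -/
def IsCompatiblePerm (q : Fin n → Fin n → K) (a : Fin n → ℕ) (σ : Equiv.Perm (Fin n)) : Prop :=
  (∀ i, a (σ i) = a i) ∧ ∀ i j, q (σ i) (σ j) = q j i

/-- `q_σ = ∏_{j < k} (q^{⟨σ(e_k)|σ(e_j)⟩}) ^ ((a_k - 1)(a_j - 1))`. -/
def qPerm (q : Fin n → Fin n → K) (a : Fin n → ℕ) (σ : Equiv.Perm (Fin n)) : K :=
  ∏ k, ∏ j ∈ Finset.univ.filter (fun j => j < k),
    strCoeff q (permVec σ (unitVec k)) (permVec σ (unitVec j)) ^ ((a k - 1) * (a j - 1))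

end QuantumCI

/-! The counit kills every `x_i`, which is nilpotent, while `S(x) = ∑ φ(t₁ x) t₂` and `ε ∘ S = ε`
give `φ(t x) = ε(x)`, hence `t x = ε(x) t`. So `t` is a multiple of the top monomial
(`exists_integral_eq`), it is a left integral as well, and `S t = t`.

Comparing `Δ(t)` with `Δ(S t)` then yields `φ(S²(z) y) = φ(y z)` (`form_antipode_antipode_mul`).
Tested on complementary monomials, this forces `π² = Id` and shows that `S²` multiplies `x_v` by
`h_v` (`perm_perm_and_coeff`). The identity passes from `φ` to the top form `φ₀`; as `φ₀ ∘ S = φ₀`,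
one gets `S⁴ = Id`, and `S²` is the Nakayama automorphism of `φ₀`.

If `π(e_i)` had degree at least 2, then `x_{π(e_i)}` would factor, and applying `S` would write a
multiple of `x_i` as a product of two nonconstant monomials. So `π` permutes the unit vectors
(`exists_perm_unitExp`), and antimultiplicativity determines `S` on all monomials (`antipode_mon`).
The remaining conditions on `σ` and the `c_i` come from applying `S` to the commutation relations
and to the top monomial. -/

/-! ### Structure coefficients -/

section StrCoeff

variable {K : Type*} [Field K] {n : ℕ}

/-- A vector of natural numbers as a vector of integers. -/
abbrev toInt (v : Fin n → ℕ) : Fin n → ℤ := fun i => (v i : ℤ)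

theorem strCoeff_succ {m : ℕ} (q : Fin (m + 1) → Fin (m + 1) → K) (u v : Fin (m + 1) → ℤ) :
    strCoeff q u v = (∏ j : Fin m, q 0 j.succ ^ (u j.succ * v 0)) *
      strCoeff (fun i j => q i.succ j.succ) (fun i => u i.succ) (fun i => v i.succ) := by
  simp [strCoeff, Finset.prod_filter, Fin.prod_univ_succ, Finset.prod_mul_distrib]

theorem strCoeff_ne_zero {q : Fin n → Fin n → K} (hq : ∀ i j, q i j ≠ 0) (u v : Fin n → ℤ) :
    strCoeff q u v ≠ 0 :=
  Finset.prod_ne_zero_iff.2 fun _ _ => Finset.prod_ne_zero_iff.2 fun _ _ => zpow_ne_zero _ (hq _ _)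

theorem strCoeff_add_left {q : Fin n → Fin n → K} (hq : ∀ i j, q i j ≠ 0) (u u' v : Fin n → ℤ) :
    strCoeff q (u + u') v = strCoeff q u v * strCoeff q u' v := by
  simp only [strCoeff, ← Finset.prod_mul_distrib]
  refine Finset.prod_congr rfl fun j _ => Finset.prod_congr rfl fun i _ => ?_
  rw [← zpow_add₀ (hq i j), Pi.add_apply, add_mul]

theorem strCoeff_add_right {q : Fin n → Fin n → K} (hq : ∀ i j, q i j ≠ 0) (u v v' : Fin n → ℤ) :
    strCoeff q u (v + v') = strCoeff q u v * strCoeff q u v' := by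
  simp only [strCoeff, ← Finset.prod_mul_distrib]
  refine Finset.prod_congr rfl fun j _ => Finset.prod_congr rfl fun i _ => ?_
  rw [← zpow_add₀ (hq i j), Pi.add_apply, mul_add]

theorem strCoeff_zero_left (q : Fin n → Fin n → K) (v : Fin n → ℤ) : strCoeff q 0 v = 1 := by
  simp [strCoeff]

theorem strCoeff_sum_left {q : Fin n → Fin n → K} (hq : ∀ i j, q i j ≠ 0) {ι : Type*}
    (s : Finset ι) (u : ι → Fin n → ℤ) (v : Fin n → ℤ) :
    strCoeff q (∑ k ∈ s, u k) v = ∏ k ∈ s, strCoeff q (u k) v := by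
  classical
  induction s using Finset.induction_on with
  | empty => simp [strCoeff_zero_left]
  | insert k s hk ih => rw [Finset.sum_insert hk, Finset.prod_insert hk, strCoeff_add_left hq, ih]

theorem strCoeff_nsmul_nsmul (q : Fin n → Fin n → K) (k l : ℕ) (u v : Fin n → ℤ) :
    strCoeff q (k • u) (l • v) = strCoeff q u v ^ (k * l) := by
  simp only [strCoeff, ← Finset.prod_pow]
  refine Finset.prod_congr rfl fun j _ => Finset.prod_congr rfl fun i _ => ?_
  rw [← zpow_natCast, ← zpow_mul]
  congr 1
  simp only [Pi.smul_apply, nsmul_eq_mul, Nat.cast_mul]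
  ring

theorem strCoeff_unitVec (q : Fin n → Fin n → K) (i j : Fin n) :
    strCoeff q (unitVec j) (unitVec i) = if i < j then q i j else 1 := by
  rw [strCoeff, Finset.prod_eq_single j _ (by simp), Finset.prod_filter,
    Finset.prod_eq_single i _ (by simp)]
  · simp [unitVec]
  · intro k _ hk
    simp [unitVec, hk]
  · intro k _ hk
    exact Finset.prod_eq_one fun l _ => by simp [unitVec, hk]

theorem permVec_unitVec (σ : Equiv.Perm (Fin n)) (k : Fin n) :
    permVec σ (unitVec k) = unitVec (σ k) := by
  ext i
  simp [permVec, unitVec, Pi.single_apply, Equiv.eq_symm_apply, eq_comm]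

end StrCoeff

/-! ### Products of skew-commuting elements -/

section SkewCommute

variable {K R : Type*} [Field K] [Ring R] [Algebra K R]

theorem pow_mul_of_skew {y z : R} {r : K} (h : y * z = r • (z * y)) (k : ℕ) :
    y ^ k * z = r ^ k • (z * y ^ k) := by
  induction k with
  | zero => simp
  | succ k ih =>
    rw [pow_succ, mul_assoc, h, mul_smul_comm, ← mul_assoc, ih, smul_mul_assoc, smul_smul,
      mul_assoc, pow_succ r, mul_comm r]

theorem mul_pow_of_skew {y z : R} {r : K} (h : y * z = r • (z * y)) (k : ℕ) :
    y * z ^ k = r ^ k • (z ^ k * y) := by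
  induction k with
  | zero => simp
  | succ k ih =>
    rw [pow_succ, ← mul_assoc, ih, smul_mul_assoc, mul_assoc, h, mul_smul_comm, smul_smul,
      ← mul_assoc, pow_succ r]

theorem prod_ofFn_mul_of_skew {m : ℕ} (y : Fin m → R) (z : R) (r : Fin m → K)
    (h : ∀ j, y j * z = r j • (z * y j)) (u : Fin m → ℕ) :
    (List.ofFn fun j => y j ^ u j).prod * z =
      (∏ j, r j ^ u j) • (z * (List.ofFn fun j => y j ^ u j).prod) := by
  induction m with
  | zero => simp
  | succ m ih =>
    rw [List.ofFn_succ, List.prod_cons, mul_assoc,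
      ih (fun j => y j.succ) (fun j => r j.succ) (fun j => h j.succ) (fun j => u j.succ),
      mul_smul_comm, ← mul_assoc, pow_mul_of_skew (h 0), smul_mul_assoc, smul_smul,
      Fin.prod_univ_succ, mul_assoc, mul_comm (r 0 ^ u 0)]

/-- Induction on the number of generators: moving the tail of the first product past `y 0 ^ v 0`
costs exactly the factors of `strCoeff` with smaller index `0`. -/
theorem prod_ofFn_mul_prod_ofFn_of_skew {m : ℕ} (y : Fin m → R) (q : Fin m → Fin m → K)
    (h : ∀ i j, y j * y i = q i j • (y i * y j)) (u v : Fin m → ℕ) :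
    (List.ofFn fun i => y i ^ u i).prod * (List.ofFn fun i => y i ^ v i).prod =
      strCoeff q (toInt u) (toInt v) • (List.ofFn fun i => y i ^ (u + v) i).prod := by
  induction m with
  | zero => simp [strCoeff]
  | succ m ih =>
    have ih' := ih (fun i => y i.succ) (fun i j => q i.succ j.succ) (fun i j => h _ _)
      (fun i => u i.succ) (fun i => v i.succ)
    have h0 := prod_ofFn_mul_of_skew (fun i : Fin m => y i.succ) (y 0 ^ v 0)
      (fun j => q 0 j.succ ^ v 0) (fun j => mul_pow_of_skew (h 0 j.succ) _) (fun i => u i.succ)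
    rw [List.ofFn_succ, List.ofFn_succ, List.ofFn_succ, List.prod_cons, List.prod_cons,
      List.prod_cons, mul_assoc, ← mul_assoc _ (y 0 ^ v 0), h0, smul_mul_assoc, mul_smul_comm,
      mul_assoc (y 0 ^ v 0), ih', mul_smul_comm, mul_smul_comm, smul_smul, ← mul_assoc, ← pow_add,
      strCoeff_succ]
    congr 2
    refine Finset.prod_congr rfl fun j _ => ?_
    rw [← pow_mul, ← zpow_natCast]
    congr 1
    push_cast
    ring

theorem prod_ofFn_pow_single {M : Type*} [Monoid M] {m : ℕ} (y : Fin m → M) (i : Fin m) (k : ℕ) :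
    (List.ofFn fun j => y j ^ (Pi.single i k : Fin m → ℕ) j).prod = y i ^ k := by
  induction m with
  | zero => exact i.elim0
  | succ m ih =>
    rw [List.ofFn_succ, List.prod_cons]
    refine Fin.cases ?_ (fun i => ?_) i
    · simp
    · have h : ∀ j : Fin m, (Pi.single i.succ k : Fin (m + 1) → ℕ) j.succ =
          (Pi.single i k : Fin m → ℕ) j := fun j => by simp [Pi.single_apply]
      simp only [h, ih (fun j => y j.succ) i]
      simp [(Fin.succ_ne_zero i).symm]

end SkewCommute

/-! ### The standard basis of a quantum complete intersection -/

namespace QuantumCI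

variable {K : Type*} [Field K] {n : ℕ} (q : Fin n → Fin n → K) (a : Fin n → ℕ)

theorem gen_pow_eq_zero (i : Fin n) : gen q a i ^ a i = 0 := by
  have h := RingQuot.mkAlgHom_rel K (QuantumCIRel.pow (q := q) (a := a) i)
  rw [map_pow, map_zero] at h
  exact h

theorem gen_mul_gen (i j : Fin n) : gen q a j * gen q a i = q i j • (gen q a i * gen q a j) := by
  have h := RingQuot.mkAlgHom_rel K (QuantumCIRel.comm (q := q) (a := a) i j)
  rw [map_smul, map_mul, map_mul] at h
  exact h

theorem mon_mul_mon (u v : Fin n → ℕ) :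
    mon q a u * mon q a v = strCoeff q (toInt u) (toInt v) • mon q a (u + v) :=
  prod_ofFn_mul_prod_ofFn_of_skew _ q (gen_mul_gen q a) u v

theorem mon_single (i : Fin n) (k : ℕ) : mon q a (Pi.single i k) = gen q a i ^ k :=
  prod_ofFn_pow_single _ i k

theorem mon_zero : mon q a 0 = 1 := by
  simp [mon]

theorem mon_eq_zero {v : Fin n → ℕ} (ha : ∀ i, 2 ≤ a i) (hv : ¬ ∀ i, v i ≤ a i - 1) :
    mon q a v = 0 := by
  push Not at hv
  obtain ⟨i, hi⟩ := hv
  refine List.prod_eq_zero (List.mem_ofFn.2 ⟨i, ?_⟩)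
  have := ha i
  exact pow_eq_zero_of_le (by omega) (gen_pow_eq_zero q a i)

/-- The span contains `1` and the generators (here `2 ≤ a i` matters) and is closed under products,
since a product of monomials is a multiple of a monomial, possibly zero. -/
theorem span_mon_eq_top (ha : ∀ i, 2 ≤ a i) :
    Submodule.span K (Set.range fun v : ExpSet a => mon q a v.1) = ⊤ := by
  set W := Submodule.span K (Set.range fun v : ExpSet a => mon q a v.1)
  have hmon : ∀ v, mon q a v ∈ W := fun v => by
    by_cases hv : ∀ i, v i ≤ a i - 1
    · exact Submodule.subset_span ⟨⟨v, hv⟩, rfl⟩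
    · rw [mon_eq_zero q a ha hv]
      exact W.zero_mem
  have hmul : ∀ x ∈ W, ∀ y ∈ W, x * y ∈ W := by
    intro x hx y hy
    induction hx using Submodule.span_induction with
    | zero => simp
    | add x x' _ _ h h' => rw [add_mul]; exact W.add_mem h h'
    | smul c x _ h => rw [smul_mul_assoc]; exact W.smul_mem c h
    | mem x hx =>
      obtain ⟨u, rfl⟩ := hx
      induction hy using Submodule.span_induction with
      | zero => simp
      | add x x' _ _ h h' => rw [mul_add]; exact W.add_mem h h'
      | smul c x _ h => rw [mul_smul_comm]; exact W.smul_mem c h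
      | mem x hx =>
        obtain ⟨v, rfl⟩ := hx
        simp only [mon_mul_mon]
        exact W.smul_mem _ (hmon _)
  have hone : (1 : QuantumCI q a) ∈ W := by
    rw [← mon_zero]
    exact hmon 0
  rw [eq_top_iff]
  rintro x -
  obtain ⟨y, rfl⟩ := RingQuot.mkAlgHom_surjective K (QuantumCIRel q a) x
  change mk q a y ∈ W
  induction y using FreeAlgebra.induction with
  | grade0 r =>
    rw [AlgHom.commutes, Algebra.algebraMap_eq_smul_one]
    exact W.smul_mem _ hone
  | grade1 i =>
    have h := hmon (Pi.single i 1)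
    rwa [mon_single, pow_one] at h
  | mul x y hx hy => rw [map_mul]; exact hmul _ hx _ hy
  | add x y hx hy => rw [map_add]; exact W.add_mem hx hy

/-- The action of `x_i` on formal monomials. -/
noncomputable def genAction (i : Fin n) : Module.End K ((Fin n → ℕ) →₀ K) :=
  Finsupp.linearCombination K fun v => if v i + 1 < a i then
    Finsupp.single (v + Pi.single i 1) (strCoeff q (unitVec i) (toInt v)) else 0

theorem genAction_single (i : Fin n) (v : Fin n → ℕ) (c : K) :
    genAction q a i (Finsupp.single v c) = if v i + 1 < a i then
      Finsupp.single (v + Pi.single i 1) (c * strCoeff q (unitVec i) (toInt v)) else 0 := by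
  rw [genAction, Finsupp.linearCombination_single]
  split_ifs <;> simp

/-- The condition `0 < k` is needed because the formal monomials include those with `a i ≤ v i`,
which the identity does not kill. -/
theorem genAction_pow_single (i : Fin n) (k : ℕ) (v : Fin n → ℕ) (c : K)
    (h : a i ≤ v i + k) (hk : 0 < k) : (genAction q a i ^ k) (Finsupp.single v c) = 0 := by
  induction k generalizing v c with
  | zero => omega
  | succ k ih =>
    rw [pow_succ, Module.End.mul_apply, genAction_single]
    split_ifs with hv
    · exact ih _ _ (by simp; omega) (by omega)
    · simp

theorem toInt_add (u v : Fin n → ℕ) : toInt (u + v) = toInt u + toInt v := by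
  ext i
  exact Nat.cast_add _ _

theorem toInt_single (i : Fin n) (k : ℕ) : toInt (Pi.single i k) = k • unitVec i := by
  ext j
  by_cases h : j = i
  · subst h
    simp [unitVec]
  · simp [unitVec, h]

variable {q} in
theorem ne_zero_of_inv (hq_inv : ∀ i j, q i j * q j i = 1) (i j : Fin n) : q i j ≠ 0 :=
  left_ne_zero_of_mul_eq_one (hq_inv i j)

/-- For `i ≠ j` the two truncation tests do not interact, and the two orders differ only by the
pairings of `e_i` with `e_j`, one of which is trivial; `q i j * q j i = 1` settles the case `j < i`.
-/
theorem genAction_comm (hq_diag : ∀ i, q i i = 1) (hq_inv : ∀ i j, q i j * q j i = 1)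
    (i j : Fin n) :
    genAction q a j * genAction q a i = q i j • (genAction q a i * genAction q a j) := by
  rcases eq_or_ne i j with rfl | hij
  · rw [hq_diag, one_smul]
  have hq := ne_zero_of_inv hq_inv
  ext v : 2
  simp only [LinearMap.comp_apply, Finsupp.lsingle_apply, LinearMap.smul_apply,
    Module.End.mul_apply, genAction_single]
  have h1 : (v + Pi.single i 1 : Fin n → ℕ) j = v j := by simp [hij.symm]
  have h2 : (v + Pi.single j 1 : Fin n → ℕ) i = v i := by simp [hij]
  split_ifs with hi hj hj
  · rw [genAction_single, genAction_single, h1, h2, if_pos hi, if_pos hj, Finsupp.smul_single,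
      add_right_comm, toInt_add, toInt_add, toInt_single, toInt_single, one_smul, one_smul,
      strCoeff_add_right hq, strCoeff_add_right hq, strCoeff_unitVec, strCoeff_unitVec]
    congr 1
    rcases lt_or_gt_of_ne hij with h | h
    · rw [if_pos h, if_neg h.asymm, smul_eq_mul]
      ring
    · rw [if_pos h, if_neg h.asymm, smul_eq_mul]
      linear_combination (-strCoeff q (unitVec i) (toInt v) * strCoeff q (unitVec j) (toInt v)) *
        hq_inv i j
  · rw [genAction_single, h1, if_neg hj]
    simp
  · rw [genAction_single, h2, if_neg hi]
    simp
  · simp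

theorem lift_genAction_rel (ha : ∀ i, 2 ≤ a i) (hq_diag : ∀ i, q i i = 1)
    (hq_inv : ∀ i j, q i j * q j i = 1) ⦃x y : FreeAlgebra K (Fin n)⦄ (h : QuantumCIRel q a x y) :
    FreeAlgebra.lift K (genAction q a) x = FreeAlgebra.lift K (genAction q a) y := by
  cases h with
  | pow i =>
    rw [map_pow, FreeAlgebra.lift_ι_apply, map_zero]
    ext v : 2
    have := ha i
    exact genAction_pow_single q a i _ v 1 (by omega) (by omega)
  | comm i j =>
    rw [map_smul, map_mul, map_mul, FreeAlgebra.lift_ι_apply, FreeAlgebra.lift_ι_apply]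
    exact genAction_comm q a hq_diag hq_inv i j

/-- The representation of `A(q, a)` on formal monomials. -/
noncomputable def monRep (ha : ∀ i, 2 ≤ a i) (hq_diag : ∀ i, q i i = 1)
    (hq_inv : ∀ i j, q i j * q j i = 1) :
    QuantumCI q a →ₐ[K] Module.End K ((Fin n → ℕ) →₀ K) :=
  RingQuot.liftAlgHom K
    ⟨FreeAlgebra.lift K (genAction q a), lift_genAction_rel q a ha hq_diag hq_inv⟩

theorem monRep_gen (ha : ∀ i, 2 ≤ a i) (hq_diag : ∀ i, q i i = 1)
    (hq_inv : ∀ i j, q i j * q j i = 1) (i : Fin n) :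
    monRep q a ha hq_diag hq_inv (gen q a i) = genAction q a i := by
  have h := RingQuot.liftAlgHom_mkAlgHom_apply K (FreeAlgebra.lift K (genAction q a))
    (lift_genAction_rel q a ha hq_diag hq_inv) (FreeAlgebra.ι K i)
  rw [FreeAlgebra.lift_ι_apply] at h
  exact h

theorem exists_eq_add_single {v : Fin n → ℕ} (hv : v ≠ 0) :
    ∃ (i : Fin n) (w : Fin n → ℕ), v = w + Pi.single i 1 := by
  obtain ⟨i, hi⟩ := Function.ne_iff.1 hv
  refine ⟨i, v - Pi.single i 1, (tsub_add_cancel_of_le fun j => ?_).symm⟩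
  by_cases h : j = i
  · subst h
    simpa [Nat.one_le_iff_ne_zero] using hi
  · simp [h]

/-- Acting on the formal monomial `1` separates the `x_v`, which gives their linear independence.
The scalar in `genAction` is the one that left multiplication by `x_i` produces, so no coefficient
survives. -/
theorem monRep_mon (ha : ∀ i, 2 ≤ a i) (hq_diag : ∀ i, q i i = 1)
    (hq_inv : ∀ i j, q i j * q j i = 1) (v : Fin n → ℕ) (hv : ∀ i, v i ≤ a i - 1) :
    monRep q a ha hq_diag hq_inv (mon q a v) (Finsupp.single 0 1) = Finsupp.single v 1 := by
  have hq := ne_zero_of_inv hq_inv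
  induction hd : ∑ i, v i generalizing v with
  | zero =>
    have : v = 0 := by
      ext i
      simpa using Finset.sum_eq_zero_iff.1 hd i
    rw [this, mon_zero, map_one, Module.End.one_apply]
  | succ d ih =>
    obtain ⟨i, w, rfl⟩ := exists_eq_add_single (v := v) (by rintro rfl; simp at hd)
    have hs : strCoeff q (unitVec i) (toInt w) ≠ 0 := strCoeff_ne_zero hq _ _
    have hm := mon_mul_mon q a (Pi.single i 1) w
    rw [mon_single, pow_one, toInt_single, one_smul, add_comm (Pi.single i 1)] at hm
    have hm' := congrArg (fun x => monRep q a ha hq_diag hq_inv x (Finsupp.single 0 1)) hm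
    have hw : w i + 1 < a i := by
      have := hv i
      have := ha i
      simp at *
      omega
    simp only [map_mul, map_smul, Module.End.mul_apply, LinearMap.smul_apply, monRep_gen] at hm'
    rw [ih w (fun j => le_trans (by simp) (hv j)) (by simpa [Finset.sum_add_distrib] using hd),
      genAction_single, if_pos hw, one_mul] at hm'
    rw [← (smul_right_injective _ hs).eq_iff, ← hm', Finsupp.smul_single, smul_eq_mul, mul_one]

theorem linearIndependent_mon (ha : ∀ i, 2 ≤ a i) (hq_diag : ∀ i, q i i = 1)
    (hq_inv : ∀ i j, q i j * q j i = 1) :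
    LinearIndependent K fun v : ExpSet a => mon q a v.1 := by
  refine LinearIndependent.of_comp ((LinearMap.applyₗ (Finsupp.single 0 1)).comp
    (monRep q a ha hq_diag hq_inv).toLinearMap) ?_
  have h : LinearIndependent K fun v : ExpSet a => (Finsupp.single v.1 1 : (Fin n → ℕ) →₀ K) := by
    simpa [Function.comp_def] using
      (Finsupp.basisSingleOne (R := K)).linearIndependent.comp (Subtype.val (p := fun v : Fin n → ℕ =>
        ∀ i, v i ≤ a i - 1)) Subtype.val_injective
  convert h using 2 with v
  exact monRep_mon q a ha hq_diag hq_inv v.1 v.2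

/-- The standard basis. -/
noncomputable def monBasis (ha : ∀ i, 2 ≤ a i) (hq_diag : ∀ i, q i i = 1)
    (hq_inv : ∀ i j, q i j * q j i = 1) : Module.Basis (ExpSet a) K (QuantumCI q a) :=
  Module.Basis.mk (linearIndependent_mon q a ha hq_diag hq_inv) (span_mon_eq_top q a ha).ge

theorem monBasis_apply (ha : ∀ i, 2 ≤ a i) (hq_diag : ∀ i, q i i = 1)
    (hq_inv : ∀ i j, q i j * q j i = 1) (v : ExpSet a) :
    monBasis q a ha hq_diag hq_inv v = mon q a v.1 := by
  simp [monBasis]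

end QuantumCI

instance {n : ℕ} (a : Fin n → ℕ) : Finite (ExpSet a) :=
  Set.Finite.to_subtype ((Set.finite_Iic (fun i => a i - 1)).subset fun _ h => h)

/-! ### General facts on bi-Frobenius algebras -/

section BiFrobenius

variable {K : Type*} [Field K]

theorem apply_lid_rTensor {C : Type*} [AddCommGroup C] [Module K C] (f g : C →ₗ[K] K)
    (z : C ⊗[K] C) :
    g (TensorProduct.lid K C (f.rTensor C z)) = f (TensorProduct.rid K C (g.lTensor C z)) := by
  induction z with
  | zero => simp
  | add x y hx hy => simp only [map_add, hx, hy]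
  | tmul x y => simp [mul_comm]

theorem lid_rTensor_comm_map {C : Type*} [AddCommGroup C] [Module K C] (f : C →ₗ[K] K)
    (S : C →ₗ[K] C) (z : C ⊗[K] C) :
    TensorProduct.lid K C (f.rTensor C (TensorProduct.comm K C C (TensorProduct.map S S z))) =
      S (TensorProduct.rid K C ((f ∘ₗ S).lTensor C z)) := by
  induction z with
  | zero => simp
  | add x y hx hy => simp only [map_add, hx, hy]
  | tmul x y => simp

theorem counit_coalgRightAct {C : Type*} [AddCommGroup C] [Module K C] [Coalgebra K C] (t : C)
    (f : C →ₗ[K] K) : CoalgebraStruct.counit (R := K) (coalgRightAct t f) = f t := by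
  rw [coalgRightAct, apply_lid_rTensor, Coalgebra.lTensor_counit_comul]
  simp

theorem coalgRightAct_counit {C : Type*} [AddCommGroup C] [Module K C] [Coalgebra K C] (t : C) :
    coalgRightAct t (CoalgebraStruct.counit (R := K)) = t := by
  rw [coalgRightAct, Coalgebra.rTensor_counit_comul]
  simp

/-- The map `f ↦ t ↼ f` is surjective between spaces of equal finite dimension, hence injective. -/
theorem IsFrobeniusCoalgElem.eq_zero {C : Type*} [AddCommGroup C] [Module K C] [Coalgebra K C]
    [FiniteDimensional K C] {t : C} (ht : IsFrobeniusCoalgElem K t) {f : C →ₗ[K] K}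
    (hf : coalgRightAct t f = 0) : f = 0 := by
  let L : (C →ₗ[K] K) →ₗ[K] C := (TensorProduct.lid K C).toLinearMap ∘ₗ
    (LinearMap.applyₗ (CoalgebraStruct.comul (R := K) t)) ∘ₗ LinearMap.rTensorHom C
  have hL : Function.Surjective L := fun c => by
    obtain ⟨f, hf⟩ := ht c
    exact ⟨f, hf.symm⟩
  have hi := (LinearMap.injective_iff_surjective_of_finrank_eq_finrank
    (Subspace.dual_finrank_eq (K := K) (V := C))).2 hL
  exact hi (by rw [map_zero]; exact hf)

variable {A : Type*} [Ring A] [Algebra K A]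

/-- The map `b ↦ b ⇀ φ`. -/
noncomputable def formAct (φ : A →ₗ[K] K) : A →ₗ[K] (A →ₗ[K] K) :=
  (LinearMap.llcomp K A A K φ) ∘ₗ (LinearMap.mul K A).flip

theorem isFrobeniusForm_iff_surjective (φ : A →ₗ[K] K) :
    IsFrobeniusForm φ ↔ Function.Surjective (formAct φ) := by
  refine forall_congr' fun f => exists_congr fun b => ?_
  rw [LinearMap.ext_iff]
  exact forall_congr' fun x => eq_comm

theorem isFrobeniusForm_iff [FiniteDimensional K A] (φ : A →ₗ[K] K) :
    IsFrobeniusForm φ ↔ ∀ b, (∀ x, φ (x * b) = 0) → b = 0 := by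
  rw [isFrobeniusForm_iff_surjective, ← LinearMap.injective_iff_surjective_of_finrank_eq_finrank
    (Subspace.dual_finrank_eq (K := K) (V := A)).symm, injective_iff_map_eq_zero]
  refine forall_congr' fun b => ?_
  rw [LinearMap.ext_iff]
  rfl

theorem IsFrobeniusForm.eq_zero_of_left {φ : A →ₗ[K] K} (hφ : IsFrobeniusForm φ) {c : A}
    (hc : ∀ b, φ (c * b) = 0) : c = 0 := by
  rw [← Module.forall_dual_apply_eq_zero_iff K]
  intro f
  obtain ⟨b, hb⟩ := hφ f
  rw [hb, hc]

namespace IsBiFrobenius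

variable [Coalgebra K A] {φ : A →ₗ[K] K} {t : A} {S : A →ₗ[K] A}

/-- Apply the counit to the formula that defines `S x`. -/
theorem form_integral_mul (h : IsBiFrobenius φ t S) (x : A) :
    φ (t * x) = CoalgebraStruct.counit (R := K) x := by
  rw [← h.counit_antipode, h.antipode_eq, counit_coalgRightAct]
  rfl

theorem form_integral (h : IsBiFrobenius φ t S) : φ t = 1 := by
  rw [← mul_one t, h.form_integral_mul, h.counit_one]

theorem integral_mul (h : IsBiFrobenius φ t S) (x : A) :
    t * x = CoalgebraStruct.counit (R := K) x • t := by
  rw [← sub_eq_zero]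
  refine h.frobenius_algebra.eq_zero_of_left fun b => ?_
  rw [sub_mul, smul_mul_assoc, map_sub, map_smul, mul_assoc, h.form_integral_mul,
    h.form_integral_mul, h.counit_mul, smul_eq_mul, sub_self]

theorem antipode_injective [FiniteDimensional K A] (h : IsBiFrobenius φ t S) :
    Function.Injective S := by
  rw [injective_iff_map_eq_zero]
  intro x hx
  rw [h.antipode_eq] at hx
  have := h.frobenius_coalgebra.eq_zero hx
  exact (isFrobeniusForm_iff φ).1 h.frobenius_algebra x fun y => LinearMap.congr_fun this y

/-- If the right integral `t` is also a left integral, it is fixed by the antipode. -/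
theorem antipode_integral (h : IsBiFrobenius φ t S)
    (ht : ∀ x, x * t = CoalgebraStruct.counit (R := K) x • t) : S t = t := by
  have : φ ∘ₗ LinearMap.mulRight K t = CoalgebraStruct.counit (R := K) := by
    ext x
    simp [ht, h.form_integral]
  rw [h.antipode_eq, this, coalgRightAct_counit]

/-- If `S` fixes `t`, then `S²` is inverse to the Nakayama automorphism of `φ`. -/
theorem form_antipode_antipode_mul [FiniteDimensional K A] (h : IsBiFrobenius φ t S)
    (ht : S t = t) (y z : A) : φ (S (S z) * y) = φ (y * z) := by
  -- In Sweedler notation, `y = ∑ φ(S(t₂) y) t₁`: after applying `S`, this is the formula for `S y`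
  -- with `Δ(t)` rewritten as `∑ S(t₂) ⊗ S(t₁)`.
  have hy : TensorProduct.rid K A (((φ ∘ₗ LinearMap.mulRight K y) ∘ₗ S).lTensor A
      (CoalgebraStruct.comul (R := K) t)) = y := by
    apply h.antipode_injective
    rw [← lid_rTensor_comm_map, ← h.comul_antipode, ht, h.antipode_eq, coalgRightAct]
  -- Both sides of the goal are `∑ φ(t₁ z) φ(S(t₂) y)`, contracted in the two possible orders.
  have := apply_lid_rTensor (φ ∘ₗ LinearMap.mulRight K z) ((φ ∘ₗ LinearMap.mulRight K y) ∘ₗ S)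
    (CoalgebraStruct.comul (R := K) t)
  rw [hy, ← coalgRightAct, ← h.antipode_eq] at this
  exact this

theorem antipode_list_prod (h : IsBiFrobenius φ t S) (l : List A) :
    S l.prod = (l.map S).reverse.prod := by
  induction l with
  | nil => simpa using h.antipode_one
  | cons x l ih => simp [h.antipode_mul, ih]

theorem antipode_pow (h : IsBiFrobenius φ t S) (x : A) (k : ℕ) : S (x ^ k) = S x ^ k := by
  induction k with
  | zero => simpa using h.antipode_one
  | succ k ih => rw [pow_succ, h.antipode_mul, ih, pow_succ']

end IsBiFrobenius

end BiFrobenius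

/-! ### Monomials and the form dual to the top monomial -/

namespace QuantumCI

variable {K : Type*} [Field K] {n : ℕ} {q : Fin n → Fin n → K} {a : Fin n → ℕ}

theorem finiteDimensional (ha : ∀ i, 2 ≤ a i) (hq_diag : ∀ i, q i i = 1)
    (hq_inv : ∀ i j, q i j * q j i = 1) : FiniteDimensional K (QuantumCI q a) :=
  Module.Basis.finiteDimensional_of_finite (monBasis q a ha hq_diag hq_inv)

theorem mon_ne_zero (ha : ∀ i, 2 ≤ a i) (hq_diag : ∀ i, q i i = 1)
    (hq_inv : ∀ i j, q i j * q j i = 1) (v : ExpSet a) : mon q a v.1 ≠ 0 := by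
  rw [← monBasis_apply q a ha hq_diag hq_inv]
  exact Module.Basis.ne_zero _ _

/-- The exponent `w` need not lie in `V`, so that products of monomials can be compared directly;
outside `V` the right side would vanish. -/
theorem eq_of_smul_mon_eq (ha : ∀ i, 2 ≤ a i) (hq_diag : ∀ i, q i i = 1)
    (hq_inv : ∀ i j, q i j * q j i = 1) (v : ExpSet a) {w : Fin n → ℕ} {c d : K} (hc : c ≠ 0)
    (h : c • mon q a v.1 = d • mon q a w) : w = v.1 ∧ c = d := by
  by_cases hw : ∀ i, w i ≤ a i - 1
  · have h' := congrArg (monBasis q a ha hq_diag hq_inv).repr h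
    change _ = (monBasis q a ha hq_diag hq_inv).repr (d • mon q a (⟨w, hw⟩ : ExpSet a).1) at h'
    rw [← monBasis_apply q a ha hq_diag hq_inv, ← monBasis_apply q a ha hq_diag hq_inv, map_smul,
      map_smul, Module.Basis.repr_self, Module.Basis.repr_self, Finsupp.smul_single,
      Finsupp.smul_single, Finsupp.single_eq_single_iff] at h'
    rcases h' with ⟨rfl, h'⟩ | ⟨h', -⟩
    · simpa using h'
    · simp [hc] at h'
  · rw [mon_eq_zero q a ha hw, smul_zero] at h
    exact absurd h (smul_ne_zero hc (mon_ne_zero ha hq_diag hq_inv v))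

/-- The complementary exponent `a - 1 - v`. -/
def compl (v : ExpSet a) : ExpSet a := ⟨fun i => a i - 1 - v.1 i, fun _ => Nat.sub_le _ _⟩

theorem compl_add (v : ExpSet a) : (compl v).1 + v.1 = (ExpSet.top a).1 :=
  funext fun i => Nat.sub_add_cancel (v.2 i)

theorem add_compl (v : ExpSet a) : v.1 + (compl v).1 = (ExpSet.top a).1 := by
  rw [add_comm, compl_add]

theorem le_of_compl_add_le {v : ExpSet a} {w : Fin n → ℕ}
    (h : ∀ i, ((compl v).1 + w) i ≤ a i - 1) : w ≤ v.1 := fun i => by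
  have h1 := h i
  have h2 := v.2 i
  simp only [compl, Pi.add_apply] at h1
  change w i ≤ v.1 i
  omega

theorem hCoeff_eq (v : ExpSet a) (ha : ∀ i, 2 ≤ a i) : hCoeff q a (toInt v.1) =
    strCoeff q (toInt (compl v).1) (toInt v.1) / strCoeff q (toInt v.1) (toInt (compl v).1) := by
  have : (fun i => (a i : ℤ) - 1 - toInt v.1 i) = toInt (compl v).1 := by
    ext i
    have h1 := v.2 i
    have h2 := ha i
    simp only [toInt, compl]
    omega
  rw [hCoeff, this]

/-- The element of the dual basis that belongs to the top monomial. -/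
noncomputable def topForm (ha : ∀ i, 2 ≤ a i) (hq_diag : ∀ i, q i i = 1)
    (hq_inv : ∀ i j, q i j * q j i = 1) : QuantumCI q a →ₗ[K] K :=
  (monBasis q a ha hq_diag hq_inv).coord (ExpSet.top a)

section TopForm

variable (ha : ∀ i, 2 ≤ a i) (hq_diag : ∀ i, q i i = 1) (hq_inv : ∀ i j, q i j * q j i = 1)

theorem isTopDual_topForm : IsTopDual (topForm ha hq_diag hq_inv) := by
  intro v
  rw [topForm, ← monBasis_apply q a ha hq_diag hq_inv, Module.Basis.coord_apply,
    Module.Basis.repr_self, Finsupp.single_apply]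

theorem topForm_mon_top : topForm ha hq_diag hq_inv (mon q a (ExpSet.top a).1) = 1 := by
  rw [isTopDual_topForm, if_pos rfl]

theorem topForm_mon_of_ne {v : Fin n → ℕ} (hv : v ≠ (ExpSet.top a).1) :
    topForm ha hq_diag hq_inv (mon q a v) = 0 := by
  by_cases h : ∀ i, v i ≤ a i - 1
  · rw [isTopDual_topForm ha hq_diag hq_inv ⟨v, h⟩, if_neg]
    exact fun e => hv (congrArg Subtype.val e)
  · rw [mon_eq_zero q a ha h, map_zero]

/-- Only the complementary monomial multiplies `x_v` into the top one, so the pairing reads off a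
single coordinate, up to a unit. -/
theorem topForm_compl_mul (v : ExpSet a) (x : QuantumCI q a) :
    topForm ha hq_diag hq_inv (mon q a (compl v).1 * x) =
      strCoeff q (toInt (compl v).1) (toInt v.1) * (monBasis q a ha hq_diag hq_inv).coord v x := by
  have h : topForm ha hq_diag hq_inv ∘ₗ LinearMap.mulLeft K (mon q a (compl v).1) =
      strCoeff q (toInt (compl v).1) (toInt v.1) • (monBasis q a ha hq_diag hq_inv).coord v := by
    refine (monBasis q a ha hq_diag hq_inv).ext fun w => ?_
    rw [LinearMap.comp_apply, LinearMap.smul_apply, Module.Basis.coord_apply,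
      Module.Basis.repr_self, monBasis_apply, LinearMap.mulLeft_apply, mon_mul_mon, map_smul]
    rcases eq_or_ne w v with rfl | hwv
    · rw [compl_add, topForm_mon_top, Finsupp.single_eq_same]
    · rw [topForm_mon_of_ne, Finsupp.single_eq_of_ne hwv.symm,
        smul_zero, smul_zero]
      rw [← compl_add v]
      intro h
      exact hwv (Subtype.ext (add_left_cancel h))
  exact LinearMap.congr_fun h x

theorem topForm_mul_compl (v : ExpSet a) (x : QuantumCI q a) :
    topForm ha hq_diag hq_inv (x * mon q a (compl v).1) =
      strCoeff q (toInt v.1) (toInt (compl v).1) * (monBasis q a ha hq_diag hq_inv).coord v x := by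
  have h : topForm ha hq_diag hq_inv ∘ₗ LinearMap.mulRight K (mon q a (compl v).1) =
      strCoeff q (toInt v.1) (toInt (compl v).1) • (monBasis q a ha hq_diag hq_inv).coord v := by
    refine (monBasis q a ha hq_diag hq_inv).ext fun w => ?_
    rw [LinearMap.comp_apply, LinearMap.smul_apply, Module.Basis.coord_apply,
      Module.Basis.repr_self, monBasis_apply, LinearMap.mulRight_apply, mon_mul_mon, map_smul]
    rcases eq_or_ne w v with rfl | hwv
    · rw [add_compl, topForm_mon_top, Finsupp.single_eq_same]
    · rw [topForm_mon_of_ne, Finsupp.single_eq_of_ne hwv.symm,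
        smul_zero, smul_zero]
      rw [← add_compl v]
      intro h
      exact hwv (Subtype.ext (add_right_cancel h))
  exact LinearMap.congr_fun h x

theorem eq_zero_of_topForm {x : QuantumCI q a} (h : ∀ y, topForm ha hq_diag hq_inv (y * x) = 0) :
    x = 0 := by
  rw [← (monBasis q a ha hq_diag hq_inv).forall_coord_eq_zero_iff]
  intro v
  have hv := h (mon q a (compl v).1)
  rw [topForm_compl_mul] at hv
  exact (mul_eq_zero.1 hv).resolve_left (strCoeff_ne_zero (ne_zero_of_inv hq_inv) _ _)

theorem isFrobeniusForm_topForm : IsFrobeniusForm (topForm ha hq_diag hq_inv) := by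
  have := finiteDimensional ha hq_diag hq_inv
  exact (isFrobeniusForm_iff _).2 fun b hb => eq_zero_of_topForm ha hq_diag hq_inv hb

end TopForm

/-- In the reversed product the factor `k` stands to the left of every factor `j < k`, whence one
structure coefficient for each such pair. -/
theorem reverse_prod_ofFn_smul_mon (hq : ∀ i j, q i j ≠ 0) {m : ℕ} (r : Fin m → K)
    (w : Fin m → Fin n → ℕ) :
    (List.ofFn fun k => r k • mon q a (w k)).reverse.prod =
      ((∏ k, ∏ j ∈ Finset.univ.filter (fun j => j < k),
        strCoeff q (toInt (w k)) (toInt (w j))) * ∏ k, r k) • mon q a (∑ k, w k) := by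
  induction m with
  | zero => simp [mon_zero]
  | succ m ih =>
    have hsum : toInt (∑ k : Fin m, w k.succ) = ∑ k : Fin m, toInt (w k.succ) := by
      ext i
      simp [toInt]
    rw [List.ofFn_succ, List.reverse_cons, List.prod_append, List.prod_singleton,
      ih (fun k => r k.succ) (fun k => w k.succ), smul_mul_smul_comm, mon_mul_mon, smul_smul, hsum,
      strCoeff_sum_left hq, Fin.sum_univ_succ w, add_comm (w 0)]
    congr 1
    simp only [Finset.prod_filter, Fin.prod_univ_succ, Finset.prod_mul_distrib]
    simp
    ring

end QuantumCI

/-! ### Permutation antipodes -/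

namespace QuantumCI

variable {K : Type*} [Field K] {n : ℕ} {q : Fin n → Fin n → K} {a : Fin n → ℕ}
  (ha : ∀ i, 2 ≤ a i) (hq_diag : ∀ i, q i i = 1) (hq_inv : ∀ i j, q i j * q j i = 1)

/-- The exponent `e_i`. -/
def unitExp (ha : ∀ i, 2 ≤ a i) (i : Fin n) : ExpSet a :=
  ⟨Pi.single i 1, fun j => by
    have h := ha j
    rcases eq_or_ne j i with rfl | hj
    · rw [Pi.single_eq_same]
      omega
    · rw [Pi.single_eq_of_ne hj]
      exact Nat.zero_le _⟩

theorem mon_unitExp (i : Fin n) : mon q a (unitExp ha i).1 = gen q a i := by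
  rw [unitExp, mon_single, pow_one]

/-- The exponent `0`. -/
def zeroExp (a : Fin n → ℕ) : ExpSet a := ⟨0, fun _ => Nat.zero_le _⟩

include hq_inv in
theorem mon_add_single (w : Fin n → ℕ) (i : Fin n) :
    ∃ k : K, mon q a (w + Pi.single i 1) = k • (gen q a i * mon q a w) := by
  have hs := strCoeff_ne_zero (ne_zero_of_inv hq_inv) (toInt (Pi.single i 1)) (toInt w)
  refine ⟨(strCoeff q (toInt (Pi.single i 1)) (toInt w))⁻¹, ?_⟩
  rw [← pow_one (gen q a i), ← mon_single, mon_mul_mon, smul_smul, inv_mul_cancel₀ hs, one_smul,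
    add_comm]

include ha in
theorem mon_mul_mon_top {v : Fin n → ℕ} (hv : v ≠ 0) :
    mon q a v * mon q a (ExpSet.top a).1 = 0 := by
  rw [mon_mul_mon, mon_eq_zero q a ha, smul_zero]
  obtain ⟨i, hi⟩ := Function.ne_iff.1 hv
  intro h
  have := h i
  simp only [ExpSet.top, Pi.add_apply, Pi.zero_apply] at this hi
  omega

variable [Coalgebra K (QuantumCI q a)] {φ : QuantumCI q a →ₗ[K] K} {t : QuantumCI q a}
  {S : QuantumCI q a →ₗ[K] QuantumCI q a} (hS : IsBiFrobenius φ t S)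

include hS in
theorem counit_gen (i : Fin n) : CoalgebraStruct.counit (R := K) (gen q a i) = 0 := by
  have hpow : ∀ k : ℕ, CoalgebraStruct.counit (R := K) (gen q a i ^ k) =
      CoalgebraStruct.counit (R := K) (gen q a i) ^ k := fun k => by
    induction k with
    | zero => simpa using hS.counit_one
    | succ k ih => rw [pow_succ, hS.counit_mul, ih, pow_succ]
  have h := hpow (a i)
  rw [gen_pow_eq_zero, map_zero] at h
  exact eq_zero_of_pow_eq_zero h.symm

include hq_inv hS in
theorem counit_mon {v : Fin n → ℕ} (hv : v ≠ 0) :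
    CoalgebraStruct.counit (R := K) (mon q a v) = 0 := by
  obtain ⟨i, w, rfl⟩ := exists_eq_add_single hv
  obtain ⟨k, hk⟩ := mon_add_single (a := a) hq_inv w i
  rw [hk, map_smul, hS.counit_mul, counit_gen hS, zero_mul, smul_zero]

include ha hq_diag hq_inv hS

/-- Multiplying `t` on the right by the complement of `x_v` reads off its `v`-coordinate; for `v`
other than the top this complement is killed by the counit, hence kills `t`. -/
theorem exists_integral_eq : ∃ τ : K, t = τ • mon q a (ExpSet.top a).1 := by
  set b := monBasis q a ha hq_diag hq_inv
  refine ⟨b.coord (ExpSet.top a) t, b.ext_elem fun v => ?_⟩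
  rw [← monBasis_apply q a ha hq_diag hq_inv, map_smul, Module.Basis.repr_self,
    Finsupp.smul_single, smul_eq_mul, mul_one]
  rcases eq_or_ne v (ExpSet.top a) with rfl | hv
  · rw [Finsupp.single_eq_same, Module.Basis.coord_apply]
  rw [Finsupp.single_eq_of_ne hv]
  have hc : (compl v).1 ≠ 0 := fun h => hv (Subtype.ext (by rw [← add_compl v, h, add_zero]))
  have h := topForm_mul_compl ha hq_diag hq_inv v t
  rw [hS.integral_mul, counit_mon hq_inv hS hc, zero_smul, map_zero] at h
  exact (mul_eq_zero.1 h.symm).resolve_left (strCoeff_ne_zero (ne_zero_of_inv hq_inv) _ _)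

theorem mul_integral (x : QuantumCI q a) : x * t = CoalgebraStruct.counit (R := K) x • t := by
  obtain ⟨τ, ht⟩ := exists_integral_eq ha hq_diag hq_inv hS
  have h : LinearMap.mulRight K t = (CoalgebraStruct.counit (R := K)).smulRight t := by
    refine (monBasis q a ha hq_diag hq_inv).ext fun v => ?_
    rw [monBasis_apply, LinearMap.mulRight_apply, LinearMap.smulRight_apply]
    rcases eq_or_ne v.1 0 with hv | hv
    · rw [hv, mon_zero, hS.counit_one, one_mul, one_smul]
    · rw [counit_mon hq_inv hS hv, zero_smul, ht, mul_smul_comm, mon_mul_mon_top ha hv,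
        smul_zero]
  exact LinearMap.congr_fun h x

theorem antipode_integral : S t = t :=
  hS.antipode_integral (mul_integral ha hq_diag hq_inv hS)

theorem form_mon_top_ne_zero : φ (mon q a (ExpSet.top a).1) ≠ 0 := by
  obtain ⟨τ, ht⟩ := exists_integral_eq ha hq_diag hq_inv hS
  intro h
  have := hS.form_integral
  rw [ht, map_smul, h, smul_zero] at this
  exact zero_ne_one this

theorem antipode_mon_top : S (mon q a (ExpSet.top a).1) = mon q a (ExpSet.top a).1 := by
  obtain ⟨τ, ht⟩ := exists_integral_eq ha hq_diag hq_inv hS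
  have hτ : τ ≠ 0 := by
    rintro rfl
    have := hS.form_integral
    rw [ht, zero_smul, map_zero] at this
    exact zero_ne_one this
  have h := antipode_integral ha hq_diag hq_inv hS
  rw [ht, map_smul] at h
  exact smul_right_injective _ hτ h

theorem antipode_injective : Function.Injective S := by
  have := finiteDimensional ha hq_diag hq_inv
  exact hS.antipode_injective

variable {π : Equiv.Perm (ExpSet a)} {c : ExpSet a → K}
  (hc : ∀ v : ExpSet a, S (mon q a v.1) = c v • mon q a (π v).1)

include hc

theorem coeff_ne_zero (v : ExpSet a) : c v ≠ 0 := by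
  intro h
  have hv := hc v
  rw [h, zero_smul, ← map_zero S] at hv
  exact mon_ne_zero ha hq_diag hq_inv v (antipode_injective ha hq_diag hq_inv hS hv)

theorem perm_eq_of_antipode {v : ExpSet a} {w : Fin n → ℕ} {d : K}
    (h : S (mon q a v.1) = d • mon q a w) : w = (π v).1 ∧ c v = d :=
  eq_of_smul_mon_eq ha hq_diag hq_inv (π v) (coeff_ne_zero ha hq_diag hq_inv hS hc v)
    ((hc v).symm.trans h)

theorem perm_top : π (ExpSet.top a) = ExpSet.top a := by
  have h := antipode_mon_top ha hq_diag hq_inv hS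
  rw [← one_smul K (mon q a (ExpSet.top a).1), map_smul, one_smul] at h
  exact (Subtype.ext (perm_eq_of_antipode ha hq_diag hq_inv hS hc h).1).symm

theorem perm_zero : π (zeroExp a) = zeroExp a := by
  have h : S (mon q a (zeroExp a).1) = (1 : K) • mon q a (zeroExp a).1 := by
    rw [zeroExp, mon_zero, hS.antipode_one, one_smul]
  exact (Subtype.ext (perm_eq_of_antipode ha hq_diag hq_inv hS hc h).1).symm

/-- Here `φ` is arbitrary and may be nonzero on lower monomials, so only products that are multiples
of the top monomial, where `φ` does not vanish, are tested. -/
theorem perm_perm_and_coeff (v : ExpSet a) :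
    π (π v) = v ∧ c v * c (π v) = hCoeff q a (toInt v.1) := by
  have hfin := finiteDimensional ha hq_diag hq_inv
  have hq := ne_zero_of_inv hq_inv
  have htop := form_mon_top_ne_zero ha hq_diag hq_inv hS
  have hcv : c v * c (π v) ≠ 0 := mul_ne_zero (coeff_ne_zero ha hq_diag hq_inv hS hc _)
    (coeff_ne_zero ha hq_diag hq_inv hS hc _)
  have hform : ∀ u : Fin n → ℕ,
      c v * c (π v) * (strCoeff q (toInt (π (π v)).1) (toInt u) *
        φ (mon q a ((π (π v)).1 + u))) =
      strCoeff q (toInt u) (toInt v.1) * φ (mon q a (u + v.1)) := fun u => by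
    have h := hS.form_antipode_antipode_mul (antipode_integral ha hq_diag hq_inv hS)
      (mon q a u) (mon q a v.1)
    rwa [hc, map_smul, hc, smul_smul, smul_mul_assoc, mon_mul_mon, mon_mul_mon, map_smul, map_smul,
      map_smul, smul_eq_mul, smul_eq_mul, smul_eq_mul] at h
  -- With `u` complementary to `π (π v)`, the left side of `hform` is nonzero, so `x_u x_v` cannot
  -- vanish. The reverse inequality uses the complement of `v`.
  have hle : v.1 ≤ (π (π v)).1 := by
    refine le_of_compl_add_le ?_
    by_contra hcon
    have h := hform (compl (π (π v))).1
    rw [add_compl, mon_eq_zero q a ha hcon, map_zero, mul_zero] at h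
    exact mul_ne_zero hcv (mul_ne_zero (strCoeff_ne_zero hq _ _) htop) h
  have hge : (π (π v)).1 ≤ v.1 := by
    refine le_of_compl_add_le ?_
    by_contra hcon
    have h := hform (compl v).1
    rw [compl_add, add_comm, mon_eq_zero q a ha hcon, map_zero, mul_zero, mul_zero] at h
    exact mul_ne_zero (strCoeff_ne_zero hq _ _) htop h.symm
  have hv : π (π v) = v := Subtype.ext (le_antisymm hge hle)
  refine ⟨hv, ?_⟩
  have h := hform (compl v).1
  rw [hv, add_compl, compl_add, ← mul_assoc] at h
  rw [hCoeff_eq v ha, eq_div_iff (strCoeff_ne_zero hq _ _)]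
  exact mul_right_cancel₀ htop h

theorem antipode_antipode_mon (v : ExpSet a) :
    S (S (mon q a v.1)) = hCoeff q a (toInt v.1) • mon q a v.1 := by
  obtain ⟨h1, h2⟩ := perm_perm_and_coeff ha hq_diag hq_inv hS hc v
  rw [hc, map_smul, hc, smul_smul, h1, h2]

theorem topForm_antipode (x : QuantumCI q a) :
    topForm ha hq_diag hq_inv (S x) = topForm ha hq_diag hq_inv x := by
  have h : topForm ha hq_diag hq_inv ∘ₗ S = topForm ha hq_diag hq_inv := by
    refine (monBasis q a ha hq_diag hq_inv).ext fun v => ?_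
    rw [LinearMap.comp_apply, monBasis_apply]
    rcases eq_or_ne v (ExpSet.top a) with rfl | hv
    · rw [antipode_mon_top ha hq_diag hq_inv hS]
    · rw [hc, map_smul, topForm_mon_of_ne, topForm_mon_of_ne, smul_zero]
      · exact fun e => hv (Subtype.ext e)
      · intro e
        rw [← perm_top ha hq_diag hq_inv hS hc] at e
        exact hv (π.injective (Subtype.ext e))
  exact LinearMap.congr_fun h x

/-- The eigenvalue `h_v` of `S²` on `x_v` does not involve `φ`; it is the ratio of the two pairings
of `x_v` with its complement, just what the top form requires. -/
theorem topForm_antipode_antipode_mul (y z : QuantumCI q a) :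
    topForm ha hq_diag hq_inv (S (S z) * y) = topForm ha hq_diag hq_inv (y * z) := by
  have h : topForm ha hq_diag hq_inv ∘ₗ LinearMap.mulRight K y ∘ₗ S ∘ₗ S =
      topForm ha hq_diag hq_inv ∘ₗ LinearMap.mulLeft K y := by
    refine (monBasis q a ha hq_diag hq_inv).ext fun v => ?_
    have h' : topForm ha hq_diag hq_inv ∘ₗ LinearMap.mulLeft K (S (S (mon q a v.1))) =
        topForm ha hq_diag hq_inv ∘ₗ LinearMap.mulRight K (mon q a v.1) := by
      refine (monBasis q a ha hq_diag hq_inv).ext fun u => ?_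
      simp only [LinearMap.comp_apply, LinearMap.mulLeft_apply, LinearMap.mulRight_apply,
        monBasis_apply]
      rw [antipode_antipode_mon ha hq_diag hq_inv hS hc, smul_mul_assoc, mon_mul_mon, mon_mul_mon,
        map_smul, map_smul, map_smul, add_comm v.1, hCoeff_eq v ha]
      rcases eq_or_ne u (compl v) with rfl | hu
      · rw [compl_add, topForm_mon_top, smul_eq_mul, smul_eq_mul, smul_eq_mul, mul_one, mul_one,
          div_mul_cancel₀ _ (strCoeff_ne_zero (ne_zero_of_inv hq_inv) _ _)]
      · rw [topForm_mon_of_ne, smul_zero, smul_zero, smul_zero]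
        rw [← compl_add v]
        exact fun e => hu (Subtype.ext (add_right_cancel e))
    rw [LinearMap.comp_apply, LinearMap.comp_apply, LinearMap.comp_apply, LinearMap.comp_apply,
      monBasis_apply]
    exact LinearMap.congr_fun h' y
  exact LinearMap.congr_fun h z

theorem antipode_pow_four (z : QuantumCI q a) : S (S (S (S z))) = z := by
  refine (sub_eq_zero.1 (eq_zero_of_topForm ha hq_diag hq_inv fun y => ?_)).symm
  have h := topForm_antipode_antipode_mul ha hq_diag hq_inv hS hc
  -- With `φ₀` the top form: `φ₀(y z) = φ₀(S²z · y) = φ₀(S y · S³z) = φ₀(S⁵z · S y) = φ₀(S(y · S⁴z))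
  -- = φ₀(y · S⁴z)`.
  rw [mul_sub, map_sub, sub_eq_zero, ← h y z, ← topForm_antipode ha hq_diag hq_inv hS hc,
    hS.antipode_mul, ← h, ← hS.antipode_mul, topForm_antipode ha hq_diag hq_inv hS hc]

/-- The square of a permutation antipode is the canonical Nakayama automorphism. -/
theorem exists_canonicalNakayama : ∃ N : QuantumCI q a ≃ₐ[K] QuantumCI q a,
    IsCanonicalNakayama N ∧ ∀ x, S (S x) = N x := by
  have h4 := antipode_pow_four ha hq_diag hq_inv hS hc
  let f : QuantumCI q a →ₐ[K] QuantumCI q a := AlgHom.ofLinearMap (S ∘ₗ S)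
    (by simp [hS.antipode_one]) (fun x y => by simp [hS.antipode_mul])
  refine ⟨AlgEquiv.ofAlgHom f f (AlgHom.ext h4) (AlgHom.ext h4), ⟨topForm ha hq_diag hq_inv,
    isTopDual_topForm ha hq_diag hq_inv, isFrobeniusForm_topForm ha hq_diag hq_inv,
    fun x y => ?_⟩, fun x => rfl⟩
  change topForm ha hq_diag hq_inv (x * y) = topForm ha hq_diag hq_inv (y * S (S x))
  -- The identity makes `S²` inverse to the Nakayama automorphism; `S⁴ = Id` removes the inverse.
  rw [← topForm_antipode_antipode_mul ha hq_diag hq_inv hS hc y, h4]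

theorem exists_perm_unitExp (i : Fin n) : ∃ j, π (unitExp ha i) = unitExp ha j := by
  have hinj := antipode_injective ha hq_diag hq_inv hS
  have hne : ∀ v : ExpSet a, v.1 ≠ 0 → (π v).1 ≠ 0 := fun v hv h => hv <| by
    have h0 : π v = π (zeroExp a) := by
      rw [perm_zero ha hq_diag hq_inv hS hc]
      exact Subtype.ext h
    rw [π.injective h0]
    rfl
  have hunit : ∀ j, (unitExp ha j).1 ≠ 0 := fun j h => by
    simpa [unitExp] using congrFun h j
  obtain ⟨j, w, hw⟩ := exists_eq_add_single (hne _ (hunit i))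
  refine ⟨j, ?_⟩
  by_contra hj
  have hw0 : w ≠ 0 := by
    rintro rfl
    exact hj (Subtype.ext (by rw [hw, zero_add]; rfl))
  have hwV : ∀ l, w l ≤ a l - 1 := fun l =>
    le_trans (by rw [hw]; exact Nat.le_add_right _ _) ((π (unitExp ha i)).2 l)
  obtain ⟨k, hk⟩ := mon_add_single (a := a) hq_inv w j
  have hS1 := hc (π (unitExp ha i))
  rw [(perm_perm_and_coeff ha hq_diag hq_inv hS hc _).1] at hS1
  -- By `hS1` this image is a multiple of `x_i`. Factoring the argument as `x_j x_w` with `w ≠ 0`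
  -- makes it a multiple of a monomial of degree at least 2, as `π` moves no nonzero exponent to
  -- `0`.
  have hS2 : S (mon q a (π (unitExp ha i)).1) =
      (k * (c ⟨w, hwV⟩ * c (unitExp ha j) *
        strCoeff q (toInt (π ⟨w, hwV⟩).1) (toInt (π (unitExp ha j)).1))) •
        mon q a ((π ⟨w, hwV⟩).1 + (π (unitExp ha j)).1) := by
    have h1 := hc ⟨w, hwV⟩
    dsimp only at h1
    rw [hw, hk, map_smul, hS.antipode_mul, h1, ← mon_unitExp ha, hc, smul_mul_smul_comm,
      mon_mul_mon, smul_smul, smul_smul, mul_assoc]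
  have h := (eq_of_smul_mon_eq ha hq_diag hq_inv _ (coeff_ne_zero ha hq_diag hq_inv hS hc _)
    (hS1.symm.trans hS2)).1
  have hsum : ∀ v : Fin n → ℕ, v ≠ 0 → 0 < ∑ l, v l := fun v hv => by
    obtain ⟨l, hl⟩ := Function.ne_iff.1 hv
    exact Finset.sum_pos' (fun _ _ => Nat.zero_le _) ⟨l, Finset.mem_univ _, Nat.pos_of_ne_zero hl⟩
  have h1 := hsum _ (hne ⟨w, hwV⟩ hw0)
  have h2 := hsum _ (hne _ (hunit j))
  have h3 := congrArg (fun v : Fin n → ℕ => ∑ l, v l) h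
  simp only [Pi.add_apply, Finset.sum_add_distrib] at h3
  have h4 : ∑ l, (unitExp ha i).1 l = 1 := by simp [unitExp]
  rw [h4] at h3
  omega

/-- The permutation of the generators that a permutation antipode induces. -/
theorem exists_gen_perm : ∃ σ : Equiv.Perm (Fin n), ∀ i, π (unitExp ha i) = unitExp ha (σ i) := by
  choose s hs using exists_perm_unitExp ha hq_diag hq_inv hS hc
  have hinj : Function.Injective (unitExp ha) := fun i j h => by
    by_contra hij
    have := congrFun (congrArg Subtype.val h) i
    simp [unitExp, hij] at this
  have hinv : Function.Involutive s := fun i => hinj (by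
    rw [← hs, ← hs, (perm_perm_and_coeff ha hq_diag hq_inv hS hc _).1])
  exact ⟨hinv.toPerm, hs⟩

omit ha hq_diag hc in
theorem antipode_mon {σ : Equiv.Perm (Fin n)} {d : Fin n → K}
    (hd : ∀ i, S (gen q a i) = d i • gen q a (σ i)) (u : Fin n → ℕ) :
    S (mon q a u) = ((∏ k, ∏ j ∈ Finset.univ.filter (fun j => j < k),
      strCoeff q (permVec σ (unitVec k)) (permVec σ (unitVec j)) ^ (u k * u j)) *
      ∏ i, d i ^ u i) • mon q a (permVec σ u) := by
  have hlist : (List.map S (List.ofFn fun i => gen q a i ^ u i)) =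
      List.ofFn fun i => d i ^ u i • mon q a (Pi.single (σ i) (u i)) := by
    rw [List.map_ofFn]
    congr 1
    funext i
    rw [Function.comp_apply, hS.antipode_pow, hd, smul_pow, mon_single]
  have hsum : ∑ k, Pi.single (σ k) (u k) = permVec σ u := by
    ext j
    rw [Finset.sum_apply, Finset.sum_eq_single (σ⁻¹ j)]
    · simp [permVec]
    · intro k _ hk
      refine Pi.single_eq_of_ne (fun h => hk ?_) _
      rw [h]
      simp
    · simp
  rw [mon, hS.antipode_list_prod, hlist, reverse_prod_ofFn_smul_mon (ne_zero_of_inv hq_inv), hsum]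
  simp only [toInt_single, strCoeff_nsmul_nsmul, permVec_unitVec]

theorem perm_eq_permVec {σ : Equiv.Perm (Fin n)} {d : Fin n → K}
    (hd : ∀ i, S (gen q a i) = d i • gen q a (σ i)) (v : ExpSet a) :
    (π v).1 = permVec σ v.1 :=
  (perm_eq_of_antipode ha hq_diag hq_inv hS hc (antipode_mon hq_inv hS hd v.1)).1.symm

end QuantumCI

theorem theorem5p2 {K : Type*} [Field K] {n : ℕ} (hn : 2 ≤ n)
    (q : Fin n → Fin n → K) (a : Fin n → ℕ) (ha : ∀ i, 2 ≤ a i)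
    (hq_diag : ∀ i, q i i = 1) (hq_inv : ∀ i j, q i j * q j i = 1)
    [Coalgebra K (QuantumCI q a)]
    (φ : QuantumCI q a →ₗ[K] K) (t : QuantumCI q a) (S : QuantumCI q a →ₗ[K] QuantumCI q a)
    (hS : IsBiFrobenius φ t S)
    (π : Equiv.Perm (ExpSet a)) (hπ : QuantumCI.IsPermutationAntipode S π) :
    S (QuantumCI.mon q a (ExpSet.top a).1) = QuantumCI.mon q a (ExpSet.top a).1 ∧
    π (ExpSet.top a) = ExpSet.top a ∧
    (∀ v, π (π v) = v) ∧
    QuantumCI.IsGraded S ∧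
    (∃ N : QuantumCI q a ≃ₐ[K] QuantumCI q a,
      QuantumCI.IsCanonicalNakayama N ∧ ∀ x, S (S x) = N x) ∧
    (∀ x, S (S (S (S x))) = x) ∧
    ∃ σ : Equiv.Perm (Fin n), IsCompatiblePerm q a σ ∧
      (∀ v : ExpSet a, (π v).1 = permVec σ v.1) ∧
      (∀ v : ExpSet a, QuantumCI.mon q a (π v).1 =
        (List.ofFn fun i => QuantumCI.gen q a i ^ v.1 (σ⁻¹ i)).prod) ∧
      ∃ c : Fin n → K,
        (∀ i, S (QuantumCI.gen q a i) = c i • QuantumCI.gen q a (σ i)) ∧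
        (∀ i, c i * c (σ i) = hCoeff q a (unitVec i)) ∧
        qPerm q a σ * ∏ i, c i ^ (a i - 1) = 1 := by

  obtain ⟨c, hc⟩ := hπ
  obtain ⟨σ, hσ⟩ := QuantumCI.exists_gen_perm ha hq_diag hq_inv hS hc
  have htop := QuantumCI.antipode_mon_top ha hq_diag hq_inv hS
  set d : Fin n → K := fun i => c (QuantumCI.unitExp ha i) with hd_def
  have hd : ∀ i, S (QuantumCI.gen q a i) = d i • QuantumCI.gen q a (σ i) := fun i => by
    rw [← QuantumCI.mon_unitExp ha, hc, hσ, QuantumCI.mon_unitExp]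
  have hperm := QuantumCI.perm_eq_permVec ha hq_diag hq_inv hS hc hd
  have hπtop := QuantumCI.perm_top ha hq_diag hq_inv hS hc
  have hpermtop : permVec σ (ExpSet.top a).1 = (ExpSet.top a).1 := by rw [← hperm, hπtop]
  have hd0 : ∀ i, d i ≠ 0 := fun i => QuantumCI.coeff_ne_zero ha hq_diag hq_inv hS hc _
  refine ⟨htop, hπtop, fun v => (QuantumCI.perm_perm_and_coeff ha hq_diag hq_inv hS hc v).1, ?_,
    QuantumCI.exists_canonicalNakayama ha hq_diag hq_inv hS hc,
    QuantumCI.antipode_pow_four ha hq_diag hq_inv hS hc, σ, ⟨fun i => ?_, fun i j => ?_⟩, hperm,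
    fun v => by rw [hperm]; rfl, d, hd, fun i => ?_, ?_⟩
  · intro e x hx
    induction hx using Submodule.span_induction with
    | zero => rw [map_zero]; exact Submodule.zero_mem _
    | add x y _ _ hx hy => rw [map_add]; exact Submodule.add_mem _ hx hy
    | smul r x _ hx => rw [map_smul]; exact Submodule.smul_mem _ _ hx
    | mem x hx =>
      obtain ⟨v, hv, rfl⟩ := hx
      rw [hc]
      refine Submodule.smul_mem _ _ (Submodule.subset_span ⟨π v, ?_, rfl⟩)
      rw [hperm, ← hv]
      exact Equiv.sum_comp σ⁻¹ v.1
  -- The entries compared are `a i - 1` and `a (σ i) - 1`; `2 ≤ a` makes the truncated subtraction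
  -- injective.
  · have h := congrFun hpermtop (σ i)
    have h1 := ha i
    have h2 := ha (σ i)
    simp only [permVec, ExpSet.top, Equiv.Perm.inv_def, Equiv.symm_apply_apply] at h
    omega
  · rcases eq_or_ne i j with rfl | hij
    · rw [hq_diag, hq_diag]
    -- Reversal by `S` turns the relation for `i, j` into one for `σ i, σ j`; comparing coefficients
    -- of the nonzero product `g` gives the condition on `q`.
    have h := congrArg S (QuantumCI.gen_mul_gen q a j i)
    rw [map_smul, hS.antipode_mul, hS.antipode_mul, hd, hd, smul_mul_smul_comm, smul_mul_smul_comm,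
      QuantumCI.gen_mul_gen q a (σ i) (σ j), smul_smul, smul_smul, mul_comm (d j)] at h
    set g := QuantumCI.gen q a (σ i) * QuantumCI.gen q a (σ j)
    have hg : g ≠ 0 := by
      have hV : ∀ l, (Pi.single (σ i) 1 + Pi.single (σ j) 1 : Fin n → ℕ) l ≤ a l - 1 := fun l => by
        have h1 := ha l
        have h2 : σ i ≠ σ j := fun e => hij (σ.injective e)
        rcases eq_or_ne l (σ i) with rfl | hl
        · simp [h2]
          omega
        · rw [Pi.add_apply, Pi.single_eq_of_ne hl, zero_add]
          exact (QuantumCI.unitExp ha (σ j)).2 l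
      intro hg
      have hm := QuantumCI.mon_mul_mon q a (Pi.single (σ i) 1) (Pi.single (σ j) 1)
      rw [QuantumCI.mon_single, QuantumCI.mon_single, pow_one, pow_one] at hm
      exact smul_ne_zero (strCoeff_ne_zero (QuantumCI.ne_zero_of_inv hq_inv) _ _)
        (QuantumCI.mon_ne_zero ha hq_diag hq_inv ⟨_, hV⟩) (hm.symm.trans hg)
    have h' := smul_left_injective K hg h
    rw [mul_comm (q j i)] at h'
    exact mul_left_cancel₀ (mul_ne_zero (hd0 i) (hd0 j)) h'
  · have h := (QuantumCI.perm_perm_and_coeff ha hq_diag hq_inv hS hc (QuantumCI.unitExp ha i)).2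
    rw [hσ] at h
    refine h.trans (congrArg _ ?_)
    exact (QuantumCI.toInt_single i 1).trans (one_smul _ _)
  -- As `S` fixes the top monomial, its coefficient in the general formula must be 1.
  · have h := QuantumCI.antipode_mon hq_inv hS hd (ExpSet.top a).1
    rw [htop, hpermtop, ← one_smul K (QuantumCI.mon q a (ExpSet.top a).1), smul_smul] at h
    have := (QuantumCI.eq_of_smul_mon_eq ha hq_diag hq_inv _ one_ne_zero h).2
    rw [mul_one] at this
    exact this.symm
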